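/- Let $\mathbb F$ be a field and let $q\in\mathbb F$ be nonzero with $q^4\neq 1$. Let $\Delta=\Delta_q$ be the universal Askey–Wilson algebra, that is, the associative unital $\mathbb F$-algebra defined by generators $A,B,C$ and the relations asserting that each of $$A+\frac{qBC-q^{-1}CB}{q^2-q^{-2}},\qquad B+\frac{qCA-q^{-1}AC}{q^2-q^{-2}},\qquad C+\frac{qAB-q^{-1}BA}{q^2-q^{-2}}$$ is central in $\Delta$. Let $\alpha,\beta,\gamma$ denote the elements of $\Delta$ obtained by multiplying these three central elements, respectively, by $q+q^{-1}$. Then the monomials $$A^iB^jC^k\alpha^r\beta^s\gamma^t,\qquad i,j,k,r,s,t\ge 0,$$ form a basis of the $\mathbb F$-vector space $\Delta$. -/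

import Mathlib

namespace UniversalAskeyWilson

/-- The letters of the three generators. -/
inductive Gen : Type
  | A
  | B
  | C

section Expr

variable {F : Type*} [Field F] {R : Type*} [Ring R] [Algebra F R]

/-- The expression `x + (q y z - q⁻¹ z y) / (q² - q⁻²)` in an `F`-algebra. -/
def centralExpr (q : F) (x y z : R) : R :=
  x + (q ^ 2 - (q⁻¹) ^ 2)⁻¹ • (q • (y * z) - q⁻¹ • (z * y))

end Expr

/-- The defining relations of the universal Askey-Wilson algebra, on the free algebra on
`A`, `B`, `C`: each of `A + (q BC - q⁻¹ CB) / (q² - q⁻²)`, `B + (q CA - q⁻¹ AC) / (q² - q⁻²)`,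
`C + (q AB - q⁻¹ BA) / (q² - q⁻²)` commutes with every element. -/
inductive Rel (F : Type*) [Field F] (q : F) : FreeAlgebra F Gen → FreeAlgebra F Gen → Prop
  | centralA (w : FreeAlgebra F Gen) :
      Rel F q
        (centralExpr q (FreeAlgebra.ι F Gen.A) (FreeAlgebra.ι F Gen.B) (FreeAlgebra.ι F Gen.C) * w)
        (w * centralExpr q (FreeAlgebra.ι F Gen.A) (FreeAlgebra.ι F Gen.B) (FreeAlgebra.ι F Gen.C))
  | centralB (w : FreeAlgebra F Gen) :
      Rel F q
        (centralExpr q (FreeAlgebra.ι F Gen.B) (FreeAlgebra.ι F Gen.C) (FreeAlgebra.ι F Gen.A) * w)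
        (w * centralExpr q (FreeAlgebra.ι F Gen.B) (FreeAlgebra.ι F Gen.C) (FreeAlgebra.ι F Gen.A))
  | centralC (w : FreeAlgebra F Gen) :
      Rel F q
        (centralExpr q (FreeAlgebra.ι F Gen.C) (FreeAlgebra.ι F Gen.A) (FreeAlgebra.ι F Gen.B) * w)
        (w * centralExpr q (FreeAlgebra.ι F Gen.C) (FreeAlgebra.ι F Gen.A) (FreeAlgebra.ι F Gen.B))

/-- The universal Askey-Wilson algebra `Δ_q` over `F`, by generators and relations. -/
abbrev Delta (F : Type*) [Field F] (q : F) : Type _ := RingQuot (Rel F q)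

section Elements

variable {F : Type*} [Field F] (q : F)

/-- The image in `Δ_q` of a generator. -/
def gen (g : Gen) : Delta F q := RingQuot.mkAlgHom F (Rel F q) (FreeAlgebra.ι F g)

/-- The generator `A` of `Δ_q`. -/
def A : Delta F q := gen q Gen.A

/-- The generator `B` of `Δ_q`. -/
def B : Delta F q := gen q Gen.B

/-- The generator `C` of `Δ_q`. -/
def C : Delta F q := gen q Gen.C

/-- `α = (q + q⁻¹) (A + (q BC - q⁻¹ CB) / (q² - q⁻²))`. -/
def α : Delta F q := (q + q⁻¹) • centralExpr q (A q) (B q) (C q)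

/-- `β = (q + q⁻¹) (B + (q CA - q⁻¹ AC) / (q² - q⁻²))`. -/
def β : Delta F q := (q + q⁻¹) • centralExpr q (B q) (C q) (A q)

/-- `γ = (q + q⁻¹) (C + (q AB - q⁻¹ BA) / (q² - q⁻²))`. -/
def γ : Delta F q := (q + q⁻¹) • centralExpr q (C q) (A q) (B q)

end Elements

end UniversalAskeyWilson

/-!
The algebra `Δ_q` is governed by the straightening rules
`B A = q² A B + d C - c γ`, `C B = q² B C + d A - c α`, `A C = q² C A + d B - c β`
with `c = q² - 1`, `d = q³ - q⁻¹` and `α`, `β`, `γ` central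
(`straightening_iff_smul_centralExpr`).

*Spanning.* Filter by the exponent of `B`: let `S n` be the span of the monomials in which this
exponent is at most `n`. The rules show by induction that left multiplication by `B` or `C` maps
`S n` into `S (n + 1)`, the point being that `C Bⁿ Cᵏ` even stays in `S n`
(`StraighteningRules.mul_mem`). So the span of all the monomials is a left ideal, and it contains
`1`.

*Independence.* A module is built in which the monomials take independent values on one vector.
Over a commutative ring `R` take the free module on vectors `e i j`, which play the role of
`Aⁱ Bʲ v` for a vector `v` with `C v = x v`. The rules for `B A` and `C A` determine `B` and `C` on
all `e i j` once they are known on all `e 0 j`; there `B (e 0 j) = e 0 (j + 1)`, while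
`C (e 0 j)` is fixed recursively by the rule for `C B`. That last rule thereby holds on the
vectors `e 0 j`, and it holds everywhere because `C B - q² B C - d A + c α` commutes with `A` as a
consequence of the other two rules (`ModuleData.opC_opB`). For
`R = F[x, α, β, γ]` the monomial `Aⁱ Bʲ Cᵏ αʳ βˢ γᵗ` sends `e 0 0` to `xᵏ αʳ βˢ γᵗ e i j`, and these
vectors form an `F`-basis of the module.
-/

namespace UniversalAskeyWilson

/-! ### The straightening rules -/

section Rules

variable {F : Type*} [Field F] {R : Type*} [Ring R] [Algebra F R]

/-- The defining expression of `Δ_q`, normalised by `q + q⁻¹`, takes the value `ζ` exactly when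
`z y` can be straightened to `y z` with correction terms `x` and `ζ`. -/
theorem straightening_iff_smul_centralExpr {q : F} (hq : q ≠ 0) (hq4 : q ^ 4 ≠ 1) (x y z ζ : R) :
    z * y = q ^ 2 • (y * z) + (q ^ 3 - q⁻¹) • x - (q ^ 2 - 1) • ζ ↔
      (q + q⁻¹) • centralExpr q x y z = ζ := by
  have h1 : q ^ 2 - 1 ≠ 0 := fun h => hq4 (by linear_combination (q ^ 2 + 1) * h)
  have h2 : q ^ 2 + 1 ≠ 0 := fun h => hq4 (by linear_combination (q ^ 2 - 1) * h)
  have h3 : q ^ 2 - (q⁻¹) ^ 2 ≠ 0 := by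
    have : q ^ 2 - (q⁻¹) ^ 2 = (q ^ 2 - 1) * (q ^ 2 + 1) * (q⁻¹) ^ 2 := by field_simp; ring
    rw [this]
    exact mul_ne_zero (mul_ne_zero h1 h2) (pow_ne_zero _ (inv_ne_zero hq))
  have hd : (q ^ 2 - 1) * ((q + q⁻¹) * (q ^ 2 - (q⁻¹) ^ 2)⁻¹) = q := by
    rw [← mul_assoc, ← div_eq_mul_inv, div_eq_iff h3]
    field_simp
    ring
  have key : (q ^ 2 - 1) • ((q + q⁻¹) • centralExpr q x y z) =
      q ^ 2 • (y * z) + (q ^ 3 - q⁻¹) • x - z * y := by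
    rw [centralExpr, smul_add, smul_add, smul_smul (q + q⁻¹), smul_smul _ _ (_ - _), hd, smul_smul,
      show (q ^ 2 - 1) * (q + q⁻¹) = q ^ 3 - q⁻¹ by field_simp; ring, smul_sub, smul_smul,
      smul_smul, mul_inv_cancel₀ hq, one_smul, ← sq]
    abel
  rw [← (smul_right_injective R h1).eq_iff (a := (q + q⁻¹) • _), key]
  constructor <;> intro h
  · rw [h]; abel
  · rw [← h]; abel

end Rules

/-! ### The monomials span -/

/-- Elements `A B C α β γ` of an `F`-algebra, the last three central, that obey the straightening
rules of `Δ_q`, with `u` in place of `q²` and arbitrary coefficients `c`, `d` of the correction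
terms. -/
structure StraighteningRules {F D : Type*} [Field F] [Ring D] [Algebra F D] (u c d : F)
    (A B C α β γ : D) : Prop where
  u_ne_zero : u ≠ 0
  α_comm : ∀ w, Commute α w
  β_comm : ∀ w, Commute β w
  γ_comm : ∀ w, Commute γ w
  B_mul_A : B * A = u • (A * B) + d • C - c • γ
  C_mul_B : C * B = u • (B * C) + d • A - c • α
  A_mul_C : A * C = u • (C * A) + d • B - c • β

namespace StraighteningRules

variable {F D : Type*} [Field F] [Ring D] [Algebra F D] {u c d : F} {A B C α β γ : D}

theorem C_mul_A (h : StraighteningRules u c d A B C α β γ) :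
    C * A = u⁻¹ • (A * C) - (u⁻¹ * d) • B + (u⁻¹ * c) • β := by
  rw [h.A_mul_C, smul_sub, smul_add, smul_smul, smul_smul, smul_smul, inv_mul_cancel₀ h.u_ne_zero,
    one_smul]
  abel

/-- The span of the monomials `Aⁱ Bʲ Cᵏ αʳ βˢ γᵗ` with `j ≤ n`. -/
def monomialSpan (F : Type*) {D : Type*} [Field F] [Ring D] [Algebra F D] (A B C α β γ : D)
    (n : ℕ) : Submodule F D :=
  Submodule.span F {w | ∃ i j k r s t : ℕ, j ≤ n ∧
    w = A ^ i * B ^ j * C ^ k * α ^ r * β ^ s * γ ^ t}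

theorem monomial_mem {n j : ℕ} (hj : j ≤ n) (i k r s t : ℕ) :
    A ^ i * B ^ j * C ^ k * α ^ r * β ^ s * γ ^ t ∈ monomialSpan F A B C α β γ n :=
  Submodule.subset_span ⟨i, j, k, r, s, t, hj, rfl⟩

theorem monomialSpan_mono : Monotone (monomialSpan F A B C α β γ) := by
  intro m n hmn
  apply Submodule.span_mono
  rintro w ⟨i, j, k, r, s, t, hj, rfl⟩
  exact ⟨i, j, k, r, s, t, hj.trans hmn, rfl⟩

/-- Left multiplication by a fixed element can be tested on monomials. -/
theorem mul_mem_of_monomial {N : Submodule F D} {n : ℕ} {y : D}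
    (h : ∀ i j k r s t : ℕ, j ≤ n → y * (A ^ i * B ^ j * C ^ k * α ^ r * β ^ s * γ ^ t) ∈ N)
    {w : D} (hw : w ∈ monomialSpan F A B C α β γ n) : y * w ∈ N := by
  have : monomialSpan F A B C α β γ n ≤ N.comap (LinearMap.mulLeft F y) := by
    refine Submodule.span_le.2 ?_
    rintro w ⟨i, j, k, r, s, t, hj, rfl⟩
    exact h i j k r s t hj
  exact this hw

theorem A_mul_mem {n : ℕ} {w : D} (hw : w ∈ monomialSpan F A B C α β γ n) :
    A * w ∈ monomialSpan F A B C α β γ n := by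
  refine mul_mem_of_monomial (fun i j k r s t hj => ?_) hw
  have := monomial_mem (F := F) (A := A) (B := B) (C := C) (α := α) (β := β) (γ := γ)
    hj (i + 1) k r s t
  simpa only [pow_succ', mul_assoc] using this

theorem α_mul_mem (h : StraighteningRules u c d A B C α β γ) {n : ℕ} {w : D}
    (hw : w ∈ monomialSpan F A B C α β γ n) : α * w ∈ monomialSpan F A B C α β γ n := by
  refine mul_mem_of_monomial (fun i j k r s t hj => ?_) hw
  have := monomial_mem (F := F) (A := A) (B := B) (C := C) (α := α) (β := β) (γ := γ)
    hj i k (r + 1) s t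
  rw [pow_succ', ← mul_assoc _ α, ← (h.α_comm _).eq] at this
  simpa only [mul_assoc] using this

theorem β_mul_mem (h : StraighteningRules u c d A B C α β γ) {n : ℕ} {w : D}
    (hw : w ∈ monomialSpan F A B C α β γ n) : β * w ∈ monomialSpan F A B C α β γ n := by
  refine mul_mem_of_monomial (fun i j k r s t hj => ?_) hw
  have := monomial_mem (F := F) (A := A) (B := B) (C := C) (α := α) (β := β) (γ := γ)
    hj i k r (s + 1) t
  rw [pow_succ', ← mul_assoc _ β, ← (h.β_comm _).eq] at this
  simpa only [mul_assoc] using this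

theorem γ_mul_mem (h : StraighteningRules u c d A B C α β γ) {n : ℕ} {w : D}
    (hw : w ∈ monomialSpan F A B C α β γ n) : γ * w ∈ monomialSpan F A B C α β γ n := by
  refine mul_mem_of_monomial (fun i j k r s t hj => ?_) hw
  have := monomial_mem (F := F) (A := A) (B := B) (C := C) (α := α) (β := β) (γ := γ)
    hj i k r s (t + 1)
  rw [pow_succ', ← mul_assoc _ γ, ← (h.γ_comm _).eq] at this
  simpa only [mul_assoc] using this

/-- Left multiplication by `B` and `C` raises the filtration by at most one on `Aⁱ w`, provided that
it does so on `w`. -/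
theorem mul_pow_mul_mem (h : StraighteningRules u c d A B C α β γ) {n : ℕ} {w : D}
    (hw : w ∈ monomialSpan F A B C α β γ n) (hB : B * w ∈ monomialSpan F A B C α β γ (n + 1))
    (hC : C * w ∈ monomialSpan F A B C α β γ (n + 1)) (i : ℕ) :
    A ^ i * w ∈ monomialSpan F A B C α β γ n ∧
      B * (A ^ i * w) ∈ monomialSpan F A B C α β γ (n + 1) ∧
      C * (A ^ i * w) ∈ monomialSpan F A B C α β γ (n + 1) := by
  induction i with
  | zero => simpa using ⟨hw, hB, hC⟩
  | succ i ih =>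
    obtain ⟨h0, h1, h2⟩ := ih
    have h0' := monomialSpan_mono (Nat.le_succ n) h0
    rw [pow_succ', mul_assoc]
    refine ⟨A_mul_mem h0, ?_, ?_⟩
    · rw [← mul_assoc, h.B_mul_A, sub_mul, add_mul, smul_mul_assoc, smul_mul_assoc, smul_mul_assoc,
        mul_assoc]
      exact sub_mem (add_mem (Submodule.smul_mem _ _ (A_mul_mem h1)) (Submodule.smul_mem _ _ h2))
        (Submodule.smul_mem _ _ (h.γ_mul_mem h0'))
    · rw [← mul_assoc, h.C_mul_A, add_mul, sub_mul, smul_mul_assoc, smul_mul_assoc, smul_mul_assoc,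
        mul_assoc]
      exact add_mem (sub_mem (Submodule.smul_mem _ _ (A_mul_mem h2)) (Submodule.smul_mem _ _ h1))
        (Submodule.smul_mem _ _ (h.β_mul_mem h0'))

/-- The monomials without `A` are better behaved under left multiplication by `C`: their level in
the filtration does not go up. This is what makes the induction on `n` close. -/
theorem mul_mem (h : StraighteningRules u c d A B C α β γ) (n : ℕ) :
    (∀ w ∈ monomialSpan F A B C α β γ n, B * w ∈ monomialSpan F A B C α β γ (n + 1) ∧
      C * w ∈ monomialSpan F A B C α β γ (n + 1)) ∧
    ∀ k r s t : ℕ, C * (B ^ n * (C ^ k * α ^ r * β ^ s * γ ^ t)) ∈ monomialSpan F A B C α β γ n := by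
  have mem : ∀ {n j : ℕ}, j ≤ n → ∀ k r s t : ℕ,
      B ^ j * (C ^ k * α ^ r * β ^ s * γ ^ t) ∈ monomialSpan F A B C α β γ n := by
    intro n j hj k r s t
    simpa only [pow_zero, one_mul, mul_assoc] using
      monomial_mem (F := F) (A := A) (B := B) (C := C) (α := α) (β := β) (γ := γ) hj 0 k r s t
  induction n using Nat.strong_induction_on with
  | _ n ih =>
  have hCB : ∀ k r s t : ℕ, C * (B ^ n * (C ^ k * α ^ r * β ^ s * γ ^ t)) ∈
      monomialSpan F A B C α β γ n := by
    intro k r s t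
    cases n with
    | zero =>
      simpa only [pow_zero, one_mul, pow_succ', mul_assoc] using mem (le_refl 0) (k + 1) r s t
    | succ n =>
      obtain ⟨h1, h2⟩ := ih n (Nat.lt_succ_self n)
      rw [pow_succ', mul_assoc, ← mul_assoc, h.C_mul_B, sub_mul, add_mul, smul_mul_assoc,
        smul_mul_assoc, smul_mul_assoc, mul_assoc B C]
      exact sub_mem (add_mem (Submodule.smul_mem _ _ (h1 _ (h2 k r s t)).1)
        (Submodule.smul_mem _ _ (A_mul_mem (mem n.le_succ k r s t))))
        (Submodule.smul_mem _ _ (h.α_mul_mem (mem n.le_succ k r s t)))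
  refine ⟨?_, hCB⟩
  have key : ∀ i j k r s t : ℕ, j ≤ n →
      B * (A ^ i * B ^ j * C ^ k * α ^ r * β ^ s * γ ^ t) ∈ monomialSpan F A B C α β γ (n + 1) ∧
      C * (A ^ i * B ^ j * C ^ k * α ^ r * β ^ s * γ ^ t) ∈
        monomialSpan F A B C α β γ (n + 1) := by
    intro i j k r s t hj
    have hC : C * (B ^ j * (C ^ k * α ^ r * β ^ s * γ ^ t)) ∈ monomialSpan F A B C α β γ j := by
      rcases hj.lt_or_eq with hlt | rfl
      · exact (ih j hlt).2 k r s t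
      · exact hCB k r s t
    have hB : B * (B ^ j * (C ^ k * α ^ r * β ^ s * γ ^ t)) ∈
        monomialSpan F A B C α β γ (n + 1) := by
      rw [← mul_assoc, ← pow_succ']
      exact mem (Nat.succ_le_succ hj) k r s t
    have := (h.mul_pow_mul_mem (mem hj k r s t) hB
      (monomialSpan_mono (hj.trans n.le_succ) hC) i).2
    simpa only [mul_assoc] using this
  exact fun w hw => ⟨mul_mem_of_monomial (fun i j k r s t hj => (key i j k r s t hj).1) hw,
    mul_mem_of_monomial (fun i j k r s t hj => (key i j k r s t hj).2) hw⟩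

/-- The span of all monomials is stable under left multiplication by the generators. -/
theorem mul_mem_iSup (h : StraighteningRules u c d A B C α β γ) {w : D}
    (hw : w ∈ ⨆ n, monomialSpan F A B C α β γ n) :
    A * w ∈ ⨆ n, monomialSpan F A B C α β γ n ∧ B * w ∈ ⨆ n, monomialSpan F A B C α β γ n ∧
      C * w ∈ ⨆ n, monomialSpan F A B C α β γ n := by
  rw [Submodule.mem_iSup_of_directed _ monomialSpan_mono.directed_le] at hw
  obtain ⟨n, hn⟩ := hw
  exact ⟨Submodule.mem_iSup_of_mem n (A_mul_mem hn),
    Submodule.mem_iSup_of_mem (n + 1) ((h.mul_mem n).1 w hn).1,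
    Submodule.mem_iSup_of_mem (n + 1) ((h.mul_mem n).1 w hn).2⟩

end StraighteningRules

/-! ### A module with basis `e i j` -/

/-- The parameters of the module: `u`, `d` are the coefficients of the straightening rules, `v` is
the inverse of `u`, the scalars `a`, `b`, `g` are the values of `c α`, `c β`, `c γ`, and `x` is the
eigenvalue of `C` on the generating vector. -/
structure ModuleData (R : Type*) [CommRing R] where
  (u v d a b g x : R)
  u_mul_v : u * v = 1

namespace ModuleData

variable {R : Type*} [CommRing R]

/-- The basis vector that represents `Aⁱ Bʲ v`. -/
noncomputable def e (R : Type*) [CommRing R] (i j : ℕ) : ℕ × ℕ →₀ R := Finsupp.single (i, j) 1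

/-- The action of `A`. -/
noncomputable def opA (R : Type*) [CommRing R] : (ℕ × ℕ →₀ R) →ₗ[R] (ℕ × ℕ →₀ R) :=
  Finsupp.lmapDomain R R fun p => (p.1 + 1, p.2)

@[simp]
theorem opA_e (i j : ℕ) : opA R (e R i j) = e R (i + 1) j := by
  simp [opA, e]

variable (D : ModuleData R)

/-- The vectors `B (e i j)` and `C (e i j)`, by recursion on `i` from the rules for `B A` and
`C A`, when `f` is the prescribed value of `C (e 0 j)`. -/
noncomputable def imageBC (f : ℕ × ℕ →₀ R) (j : ℕ) : ℕ → (ℕ × ℕ →₀ R) × (ℕ × ℕ →₀ R)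
  | 0 => (e R 0 (j + 1), f)
  | i + 1 =>
    (D.u • opA R (imageBC f j i).1 + D.d • (imageBC f j i).2 - D.g • e R i j,
      D.v • opA R (imageBC f j i).2 - (D.v * D.d) • (imageBC f j i).1 + (D.v * D.b) • e R i j)

/-- The action of `B` for prescribed values `f j` of `C (e 0 j)`. -/
noncomputable def extB (f : ℕ → ℕ × ℕ →₀ R) : (ℕ × ℕ →₀ R) →ₗ[R] (ℕ × ℕ →₀ R) :=
  Finsupp.linearCombination R fun p => (D.imageBC (f p.2) p.2 p.1).1

/-- The action of `C` for prescribed values `f j` of `C (e 0 j)`. -/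
noncomputable def extC (f : ℕ → ℕ × ℕ →₀ R) : (ℕ × ℕ →₀ R) →ₗ[R] (ℕ × ℕ →₀ R) :=
  Finsupp.linearCombination R fun p => (D.imageBC (f p.2) p.2 p.1).2

@[simp]
theorem extB_e (f : ℕ → ℕ × ℕ →₀ R) (i j : ℕ) : D.extB f (e R i j) = (D.imageBC (f j) j i).1 := by
  simp [extB, e]

@[simp]
theorem extC_e (f : ℕ → ℕ × ℕ →₀ R) (i j : ℕ) : D.extC f (e R i j) = (D.imageBC (f j) j i).2 := by
  simp [extC, e]

/-- Linear maps that agree on the vectors `e i j` are equal. -/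
theorem linearMap_ext {M : Type*} [AddCommGroup M] [Module R M] {φ ψ : (ℕ × ℕ →₀ R) →ₗ[R] M}
    (h : ∀ i j, φ (e R i j) = ψ (e R i j)) : φ = ψ :=
  Finsupp.lhom_ext' fun p => LinearMap.ext_ring (h p.1 p.2)

theorem extB_opA (f : ℕ → ℕ × ℕ →₀ R) (w : ℕ × ℕ →₀ R) :
    D.extB f (opA R w) = D.u • opA R (D.extB f w) + D.d • D.extC f w - D.g • w := by
  have : D.extB f ∘ₗ opA R =
      D.u • opA R ∘ₗ D.extB f + D.d • D.extC f - D.g • LinearMap.id :=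
    linearMap_ext fun i j => by simp [imageBC]
  simpa using LinearMap.congr_fun this w

theorem extC_opA (f : ℕ → ℕ × ℕ →₀ R) (w : ℕ × ℕ →₀ R) :
    D.extC f (opA R w) =
      D.v • opA R (D.extC f w) - (D.v * D.d) • D.extB f w + (D.v * D.b) • w := by
  have : D.extC f ∘ₗ opA R =
      D.v • opA R ∘ₗ D.extC f - (D.v * D.d) • D.extB f + (D.v * D.b) • LinearMap.id :=
    linearMap_ext fun i j => by simp [imageBC]
  simpa using LinearMap.congr_fun this w

/-- The span of the `e i j` with `j ≤ n`. -/
noncomputable def level (R : Type*) [CommRing R] (n : ℕ) : Submodule R (ℕ × ℕ →₀ R) :=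
  Submodule.span R {w | ∃ i j : ℕ, j ≤ n ∧ w = e R i j}

theorem e_mem_level {j n : ℕ} (hj : j ≤ n) (i : ℕ) : e R i j ∈ level R n :=
  Submodule.subset_span ⟨i, j, hj, rfl⟩

theorem level_mono : Monotone (level R) := by
  intro m n hmn
  apply Submodule.span_mono
  rintro w ⟨i, j, hj, rfl⟩
  exact ⟨i, j, hj.trans hmn, rfl⟩

theorem map_mem_of_e {N : Submodule R (ℕ × ℕ →₀ R)} {n : ℕ}
    {φ : (ℕ × ℕ →₀ R) →ₗ[R] (ℕ × ℕ →₀ R)} (h : ∀ i j, j ≤ n → φ (e R i j) ∈ N)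
    {w : ℕ × ℕ →₀ R} (hw : w ∈ level R n) : φ w ∈ N := by
  have : level R n ≤ N.comap φ := by
    refine Submodule.span_le.2 ?_
    rintro w ⟨i, j, hj, rfl⟩
    exact h i j hj
  exact this hw

theorem opA_mem_level {n : ℕ} {w : ℕ × ℕ →₀ R} (hw : w ∈ level R n) : opA R w ∈ level R n :=
  map_mem_of_e (fun i j hj => by rw [opA_e]; exact e_mem_level hj _) hw

theorem imageBC_mem_level {f : ℕ × ℕ →₀ R} {j : ℕ} (hf : f ∈ level R j) (i : ℕ) :
    (D.imageBC f j i).1 ∈ level R (j + 1) ∧ (D.imageBC f j i).2 ∈ level R (j + 1) := by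
  induction i with
  | zero => exact ⟨e_mem_level le_rfl 0, level_mono j.le_succ hf⟩
  | succ i ih =>
    have he : e R i j ∈ level R (j + 1) := e_mem_level j.le_succ i
    exact ⟨sub_mem (add_mem (Submodule.smul_mem _ _ (opA_mem_level ih.1))
        (Submodule.smul_mem _ _ ih.2)) (Submodule.smul_mem _ _ he),
      add_mem (sub_mem (Submodule.smul_mem _ _ (opA_mem_level ih.2))
        (Submodule.smul_mem _ _ ih.1)) (Submodule.smul_mem _ _ he)⟩

/-- `B` on `level n` depends only on the values `f 0, …, f n`. -/
theorem extB_congr {f f' : ℕ → ℕ × ℕ →₀ R} {n : ℕ} (h : ∀ j ≤ n, f j = f' j)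
    {w : ℕ × ℕ →₀ R} (hw : w ∈ level R n) : D.extB f w = D.extB f' w := by
  refine LinearMap.eqOn_span (s := {w | ∃ i j : ℕ, j ≤ n ∧ w = e R i j}) ?_ hw
  rintro w ⟨i, j, hj, rfl⟩
  simp [h j hj]

/-- The `n`-th function gives the intended values of `C (e 0 j)` for `j ≤ n`. The next value comes
from the rule for `C B` on `e 0 n`, in which `B` has to be known only on `level n`; storing the
values found so far in a function turns this nested recursion into a structural one. -/
noncomputable def imageCTable : ℕ → ℕ → ℕ × ℕ →₀ R
  | 0 => fun _ => D.x • e R 0 0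
  | n + 1 => Function.update (imageCTable n) (n + 1)
      (D.u • D.extB (imageCTable n) (imageCTable n n) + D.d • e R 1 n - D.a • e R 0 n)

/-- The vector `C (e 0 n)`. -/
noncomputable def imageC (n : ℕ) : ℕ × ℕ →₀ R := D.imageCTable n n

theorem imageCTable_of_le {j n : ℕ} (h : j ≤ n) : D.imageCTable n j = D.imageC j := by
  induction n, h using Nat.le_induction with
  | base => rfl
  | succ n hn ih =>
    rw [imageCTable, Function.update_of_ne (by omega), ih]

theorem imageC_succ_eq_table (n : ℕ) : D.imageC (n + 1) =
    D.u • D.extB (D.imageCTable n) (D.imageC n) + D.d • e R 1 n - D.a • e R 0 n := by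
  simp [imageC, imageCTable]

theorem imageC_mem_level (n : ℕ) : D.imageC n ∈ level R n := by
  induction n using Nat.strong_induction_on with
  | _ n ih =>
  cases n with
  | zero => exact Submodule.smul_mem _ _ (e_mem_level le_rfl 0)
  | succ n =>
    rw [imageC_succ_eq_table]
    refine sub_mem (add_mem (Submodule.smul_mem _ _ ?_) (Submodule.smul_mem _ _
      (e_mem_level n.le_succ 1))) (Submodule.smul_mem _ _ (e_mem_level n.le_succ 0))
    refine map_mem_of_e (fun i j hj => ?_) (ih n n.lt_succ_self)
    rw [extB_e, D.imageCTable_of_le hj]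
    exact level_mono (Nat.succ_le_succ hj) (D.imageBC_mem_level (ih j (Nat.lt_succ_of_le hj)) i).1

/-- The action of `B`. -/
noncomputable def opB : (ℕ × ℕ →₀ R) →ₗ[R] (ℕ × ℕ →₀ R) := D.extB D.imageC

/-- The action of `C`. -/
noncomputable def opC : (ℕ × ℕ →₀ R) →ₗ[R] (ℕ × ℕ →₀ R) := D.extC D.imageC

theorem imageC_succ (n : ℕ) :
    D.imageC (n + 1) = D.u • D.opB (D.imageC n) + D.d • e R 1 n - D.a • e R 0 n := by
  rw [imageC_succ_eq_table, opB,
    D.extB_congr (fun j hj => D.imageCTable_of_le hj) (D.imageC_mem_level n)]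

theorem opB_e_zero (j : ℕ) : D.opB (e R 0 j) = e R 0 (j + 1) := by
  simp [opB, imageBC]

theorem opC_e_zero (j : ℕ) : D.opC (e R 0 j) = D.imageC j := by
  simp [opC, imageBC]

theorem opC_e_zero_zero : D.opC (e R 0 0) = D.x • e R 0 0 := D.opC_e_zero 0

theorem opB_opA (w : ℕ × ℕ →₀ R) :
    D.opB (opA R w) = D.u • opA R (D.opB w) + D.d • D.opC w - D.g • w := D.extB_opA _ w

theorem opC_opA (w : ℕ × ℕ →₀ R) :
    D.opC (opA R w) = D.v • opA R (D.opC w) - (D.v * D.d) • D.opB w + (D.v * D.b) • w :=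
  D.extC_opA _ w

theorem opA_opC (w : ℕ × ℕ →₀ R) :
    opA R (D.opC w) = D.u • D.opC (opA R w) + D.d • D.opB w - D.b • w := by
  rw [opC_opA, smul_add, smul_sub, smul_smul, smul_smul, smul_smul, ← mul_assoc, ← mul_assoc,
    D.u_mul_v, one_smul, one_mul, one_mul]
  abel

/-- The rule for `C B` holds on `e 0 j` by construction. It propagates to `e i j` because the
difference of its two sides commutes with `A`: this is the one overlap ambiguity `C B A`. -/
theorem opC_opB (w : ℕ × ℕ →₀ R) :
    D.opC (D.opB w) = D.u • D.opB (D.opC w) + D.d • opA R w - D.a • w := by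
  have : D.opC ∘ₗ D.opB = D.u • D.opB ∘ₗ D.opC + D.d • opA R - D.a • LinearMap.id := by
    refine linearMap_ext fun i j => ?_
    induction i with
    | zero => simp [opB_e_zero, opC_e_zero, imageC_succ]
    | succ i ih =>
      simp only [LinearMap.comp_apply, LinearMap.sub_apply, LinearMap.add_apply,
        LinearMap.smul_apply, LinearMap.id_apply] at ih ⊢
      rw [← opA_e]
      set w := e R i j
      have huv := D.u_mul_v
      simp only [opB_opA, opC_opA, map_add, map_sub, map_smul, ih]
      match_scalars <;>
        first
        | ring1
        | linear_combination D.d * huv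
        | linear_combination -D.d * huv
        | linear_combination -D.a * huv
        | linear_combination D.g * huv
  simpa using LinearMap.congr_fun this w

theorem opA_pow_opB_pow (i j : ℕ) : (opA R ^ i) ((D.opB ^ j) (e R 0 0)) = e R i j := by
  have hB : (D.opB ^ j) (e R 0 0) = e R 0 j := by
    induction j with
    | zero => rfl
    | succ j ih => rw [pow_succ', Module.End.mul_apply, ih, opB_e_zero]
  rw [hB]
  induction i with
  | zero => rfl
  | succ i ih => rw [pow_succ', Module.End.mul_apply, ih, opA_e]

theorem opC_pow (k : ℕ) : (D.opC ^ k) (e R 0 0) = D.x ^ k • e R 0 0 := by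
  induction k with
  | zero => simp
  | succ k ih => rw [pow_succ', Module.End.mul_apply, ih, map_smul, opC_e_zero_zero, smul_smul,
      ← pow_succ]

end ModuleData

/-! ### The basis -/

section Basis

variable {F : Type*} [Field F] {q : F}

/-- Each defining expression is mapped to the corresponding expression in `Δ_q`. -/
theorem mkAlgHom_centralExpr (x y z : Gen) :
    RingQuot.mkAlgHom F (Rel F q)
      (centralExpr q (FreeAlgebra.ι F x) (FreeAlgebra.ι F y) (FreeAlgebra.ι F z)) =
    centralExpr q (gen q x) (gen q y) (gen q z) := by
  simp [centralExpr, gen]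

theorem α_commute (w : Delta F q) : Commute (α q) w := by
  obtain ⟨w, rfl⟩ := RingQuot.mkAlgHom_surjective F (Rel F q) w
  refine Commute.smul_left ?_ _
  have := RingQuot.mkAlgHom_rel F (Rel.centralA (q := q) w)
  rwa [map_mul, map_mul, mkAlgHom_centralExpr] at this

theorem β_commute (w : Delta F q) : Commute (β q) w := by
  obtain ⟨w, rfl⟩ := RingQuot.mkAlgHom_surjective F (Rel F q) w
  refine Commute.smul_left ?_ _
  have := RingQuot.mkAlgHom_rel F (Rel.centralB (q := q) w)
  rwa [map_mul, map_mul, mkAlgHom_centralExpr] at this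

theorem γ_commute (w : Delta F q) : Commute (γ q) w := by
  obtain ⟨w, rfl⟩ := RingQuot.mkAlgHom_surjective F (Rel F q) w
  refine Commute.smul_left ?_ _
  have := RingQuot.mkAlgHom_rel F (Rel.centralC (q := q) w)
  rwa [map_mul, map_mul, mkAlgHom_centralExpr] at this

theorem straighteningRules (hq : q ≠ 0) (hq4 : q ^ 4 ≠ 1) :
    StraighteningRules (q ^ 2) (q ^ 2 - 1) (q ^ 3 - q⁻¹) (A q) (B q) (C q) (α q) (β q) (γ q) where
  u_ne_zero := pow_ne_zero 2 hq
  α_comm := α_commute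
  β_comm := β_commute
  γ_comm := γ_commute
  B_mul_A := (straightening_iff_smul_centralExpr hq hq4 _ _ _ _).2 rfl
  C_mul_B := (straightening_iff_smul_centralExpr hq hq4 _ _ _ _).2 rfl
  A_mul_C := (straightening_iff_smul_centralExpr hq hq4 _ _ _ _).2 rfl

/-- The family of monomials in `Δ_q`. -/
noncomputable def monomial (q : F) (m : ℕ × ℕ × ℕ × ℕ × ℕ × ℕ) : Delta F q :=
  A q ^ m.1 * B q ^ m.2.1 * C q ^ m.2.2.1 * α q ^ m.2.2.2.1 * β q ^ m.2.2.2.2.1 *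
    γ q ^ m.2.2.2.2.2

theorem span_monomial (hq : q ≠ 0) (hq4 : q ^ 4 ≠ 1) :
    ⊤ ≤ Submodule.span F (Set.range (monomial q)) := by
  have h := straighteningRules hq hq4
  set S := ⨆ n, StraighteningRules.monomialSpan F (A q) (B q) (C q) (α q) (β q) (γ q) n with hS
  have hle : S ≤ Submodule.span F (Set.range (monomial q)) := by
    refine iSup_le fun n => Submodule.span_mono ?_
    rintro w ⟨i, j, k, r, s, t, -, rfl⟩
    exact ⟨(i, j, k, r, s, t), rfl⟩
  have hone : (1 : Delta F q) ∈ S := Submodule.mem_iSup_of_mem 0 <| by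
    simpa using StraighteningRules.monomial_mem (F := F) (A := A q) (B := B q) (C := C q)
      (α := α q) (β := β q) (γ := γ q) (le_refl 0) 0 0 0 0 0
  have hideal : ∀ (w : FreeAlgebra F Gen), ∀ m ∈ S, RingQuot.mkAlgHom F (Rel F q) w * m ∈ S := by
    intro w
    induction w using FreeAlgebra.induction with
    | grade0 c =>
      intro m hm
      rw [AlgHom.commutes, ← Algebra.smul_def]
      exact Submodule.smul_mem _ _ hm
    | grade1 x =>
      intro m hm
      cases x
      · exact (h.mul_mem_iSup hm).1
      · exact (h.mul_mem_iSup hm).2.1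
      · exact (h.mul_mem_iSup hm).2.2
    | mul a b ha hb =>
      intro m hm
      rw [map_mul, mul_assoc]
      exact ha _ (hb _ hm)
    | add a b ha hb =>
      intro m hm
      rw [map_add, add_mul]
      exact add_mem (ha _ hm) (hb _ hm)
  intro w _
  obtain ⟨w, rfl⟩ := RingQuot.mkAlgHom_surjective F (Rel F q) w
  simpa using hle (hideal w 1 hone)

/-- The parameters for the module over `F[x, α, β, γ]`, these four being the variables
`X 0, …, X 3`. -/
noncomputable def genericData (hq : q ≠ 0) : ModuleData (MvPolynomial (Fin 4) F) where
  u := MvPolynomial.C (q ^ 2)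
  v := MvPolynomial.C ((q ^ 2)⁻¹)
  d := MvPolynomial.C (q ^ 3 - q⁻¹)
  a := MvPolynomial.C (q ^ 2 - 1) * MvPolynomial.X 1
  b := MvPolynomial.C (q ^ 2 - 1) * MvPolynomial.X 2
  g := MvPolynomial.C (q ^ 2 - 1) * MvPolynomial.X 3
  x := MvPolynomial.X 0
  u_mul_v := by rw [← map_mul, mul_inv_cancel₀ (pow_ne_zero 2 hq), map_one]

/-- The straightening rules with a scalar `p` as last term, stated for linear operators. -/
theorem smul_centralExpr_eq_algebraMap {P M : Type*} [CommRing P] [Algebra F P] [AddCommGroup M]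
    [Module P M] [Module F M] [IsScalarTower F P M] (hq : q ≠ 0) (hq4 : q ^ 4 ≠ 1)
    {x y z : Module.End P M} {p : P}
    (h : ∀ w, z (y w) = algebraMap F P (q ^ 2) • y (z w) + algebraMap F P (q ^ 3 - q⁻¹) • x w -
      (algebraMap F P (q ^ 2 - 1) * p) • w) :
    (q + q⁻¹) • centralExpr q x y z = algebraMap P (Module.End P M) p := by
  refine (straightening_iff_smul_centralExpr hq hq4 _ _ _ _).1 (LinearMap.ext fun w => ?_)
  rw [Module.End.mul_apply, h, mul_smul]
  simp only [algebraMap_smul]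
  rfl

/-- The action of `Δ_q` on the module with the parameters `genericData`. -/
theorem exists_action (hq : q ≠ 0) (hq4 : q ^ 4 ≠ 1) :
    ∃ φ : Delta F q →ₐ[F] Module.End (MvPolynomial (Fin 4) F) (ℕ × ℕ →₀ MvPolynomial (Fin 4) F),
      φ (A q) = ModuleData.opA _ ∧ φ (B q) = (genericData hq).opB ∧
      φ (C q) = (genericData hq).opC ∧
      φ (α q) = algebraMap (MvPolynomial (Fin 4) F) _ (MvPolynomial.X 1) ∧
      φ (β q) = algebraMap (MvPolynomial (Fin 4) F) _ (MvPolynomial.X 2) ∧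
      φ (γ q) = algebraMap (MvPolynomial (Fin 4) F) _ (MvPolynomial.X 3) := by
  let D := genericData hq
  let P := MvPolynomial (Fin 4) F
  let E := Module.End P (ℕ × ℕ →₀ P)
  let act : Gen → E := fun x => Gen.rec (ModuleData.opA P) D.opB D.opC x
  have hA : (q + q⁻¹) • centralExpr q (act Gen.A) (act Gen.B) (act Gen.C) =
      algebraMap P E (MvPolynomial.X 1) :=
    smul_centralExpr_eq_algebraMap hq hq4 D.opC_opB
  have hB : (q + q⁻¹) • centralExpr q (act Gen.B) (act Gen.C) (act Gen.A) =
      algebraMap P E (MvPolynomial.X 2) :=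
    smul_centralExpr_eq_algebraMap hq hq4 D.opA_opC
  have hC : (q + q⁻¹) • centralExpr q (act Gen.C) (act Gen.A) (act Gen.B) =
      algebraMap P E (MvPolynomial.X 3) :=
    smul_centralExpr_eq_algebraMap hq hq4 D.opB_opA
  have hs : q + q⁻¹ ≠ 0 := fun h => hq4 <| by
    have : q ^ 2 + 1 = 0 := by
      have := congrArg (q * ·) h
      simpa [mul_add, hq, sq] using this
    linear_combination (q ^ 2 - 1) * this
  -- An element is central once a nonzero multiple of it is a scalar.
  have hcomm : ∀ {y w : E} {p : P}, (q + q⁻¹) • y = algebraMap P E p → y * w = w * y := by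
    intro y w p h
    apply smul_right_injective E hs
    beta_reduce
    rw [← smul_mul_assoc, ← mul_smul_comm, h, Algebra.commutes]
  let φ₀ : FreeAlgebra F Gen →ₐ[F] E := FreeAlgebra.lift F act
  have hφ₀ : ∀ x y z, φ₀ (centralExpr q (FreeAlgebra.ι F x) (FreeAlgebra.ι F y)
      (FreeAlgebra.ι F z)) = centralExpr q (act x) (act y) (act z) := by
    intro x y z
    simp [centralExpr, φ₀]
  have hrel : ∀ ⦃y z⦄, Rel F q y z → φ₀ y = φ₀ z := by
    rintro y z (w | w | w) <;> rw [map_mul, map_mul, hφ₀]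
    exacts [hcomm hA, hcomm hB, hcomm hC]
  let φ : Delta F q →ₐ[F] E := RingQuot.liftAlgHom F ⟨φ₀, hrel⟩
  have hgen : ∀ x, φ (gen q x) = act x := fun x => by
    simp [φ, gen, φ₀]
  have hφ : ∀ x y z, φ ((q + q⁻¹) • centralExpr q (gen q x) (gen q y) (gen q z)) =
      (q + q⁻¹) • centralExpr q (act x) (act y) (act z) := by
    intro x y z
    simp [centralExpr, hgen]
  exact ⟨φ, hgen _, hgen _, hgen _, (hφ _ _ _).trans hA, (hφ _ _ _).trans hB, (hφ _ _ _).trans hC⟩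

/-- The exponents of `x, α, β, γ` and those of `A, B` that belong to an index of a monomial. -/
noncomputable def exponents (m : ℕ × ℕ × ℕ × ℕ × ℕ × ℕ) : (Fin 4 →₀ ℕ) × ℕ × ℕ :=
  (Finsupp.equivFunOnFinite.symm ![m.2.2.1, m.2.2.2.1, m.2.2.2.2.1, m.2.2.2.2.2], m.1, m.2.1)

theorem exponents_injective : Function.Injective exponents := by
  rintro ⟨i, j, k, r, s, t⟩ ⟨i', j', k', r', s', t'⟩ h
  simpa [exponents, and_assoc, and_comm, and_left_comm] using h

theorem linearIndependent_monomial (hq : q ≠ 0) (hq4 : q ^ 4 ≠ 1) :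
    LinearIndependent F (monomial q) := by
  obtain ⟨φ, hA, hB, hC, hα, hβ, hγ⟩ := exists_action hq hq4
  let ev : Delta F q →ₗ[F] (ℕ × ℕ →₀ MvPolynomial (Fin 4) F) :=
    (LinearMap.applyₗ (ModuleData.e (MvPolynomial (Fin 4) F) 0 0)).restrictScalars F ∘ₗ
      φ.toLinearMap
  let b := (MvPolynomial.basisMonomials (Fin 4) F).smulTower
    (Finsupp.basisSingleOne (R := MvPolynomial (Fin 4) F) (ι := ℕ × ℕ))
  have hb : ev ∘ monomial q = b ∘ exponents := by
    funext ⟨i, j, k, r, s, t⟩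
    have hs : ∀ (p : MvPolynomial (Fin 4) F) (w : ℕ × ℕ →₀ MvPolynomial (Fin 4) F) (n : ℕ),
        (algebraMap _ (Module.End (MvPolynomial (Fin 4) F) _) p ^ n) w = p ^ n • w := by
      intro p w n
      rw [← map_pow, Module.algebraMap_end_apply]
    have h1 : ev (monomial q (i, j, k, r, s, t)) =
        φ (monomial q (i, j, k, r, s, t)) (ModuleData.e _ 0 0) := rfl
    have hx : (genericData hq).x = MvPolynomial.X 0 := rfl
    have h2 : b (exponents (i, j, k, r, s, t)) =
        MvPolynomial.monomial (exponents (i, j, k, r, s, t)).1 (1 : F) •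
          ModuleData.e (MvPolynomial (Fin 4) F) i j := by
      simp [b, Module.Basis.smulTower_apply, ModuleData.e, exponents]
    have h3 : MvPolynomial.monomial (exponents (i, j, k, r, s, t)).1 (1 : F) =
        MvPolynomial.X 1 ^ r * (MvPolynomial.X 2 ^ s * (MvPolynomial.X 3 ^ t *
          MvPolynomial.X 0 ^ k)) := by
      rw [MvPolynomial.monomial_eq, Finsupp.prod_fintype _ _ fun _ => pow_zero _]
      simp [Fin.prod_univ_four, exponents]
      ring
    rw [Function.comp_apply, Function.comp_apply, h1, h2, h3]
    simp only [monomial, map_mul, map_pow, Module.End.mul_apply, hA, hB, hC, hα, hβ, hγ, hs,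
      map_smul, ModuleData.opC_pow, hx, ModuleData.opA_pow_opB_pow, smul_smul, mul_assoc]
  refine LinearIndependent.of_comp ev ?_
  rw [hb]
  exact b.linearIndependent.comp _ exponents_injective

end Basis

end UniversalAskeyWilson

theorem theorem4p1 {F : Type*} [Field F] (q : F) (hq : q ≠ 0) (hq4 : q ^ 4 ≠ 1) :
    ∃ b : Module.Basis (ℕ × ℕ × ℕ × ℕ × ℕ × ℕ) F (UniversalAskeyWilson.Delta F q),
      ∀ i j k r s t : ℕ,
        b (i, j, k, r, s, t) =
          UniversalAskeyWilson.A q ^ i * UniversalAskeyWilson.B q ^ j *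
            UniversalAskeyWilson.C q ^ k * UniversalAskeyWilson.α q ^ r *
              UniversalAskeyWilson.β q ^ s * UniversalAskeyWilson.γ q ^ t := by
  exact ⟨.mk (UniversalAskeyWilson.linearIndependent_monomial hq hq4)
    (UniversalAskeyWilson.span_monomial hq hq4), fun i j k r s t => Module.Basis.mk_apply _ _ _⟩
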